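/- Let $\tilde r=(r_i)_{i\ge1}$ and $\tilde s=(s_i)_{i\ge1}$ be probability vectors with $\mu:=\sum_{i\ge1} r_is_i>0$. On a probability space let $L_{\mathbf R}(1),L_{\mathbf R}(2),\dots$ and $L_{\mathbf S}(1),L_{\mathbf S}(2),\dots$ be mutually independent random variables with $P(L_{\mathbf R}(j)=i)=r_i$ and $P(L_{\mathbf S}(j)=i)=s_i$ for all $i,j\ge 1$ (the labels on the successive records of two sources $\mathbf R$ and $\mathbf S$). Let $\mathcal F_0$ be a $\sigma$-algebra of events that is independent of all these labels. For a $\{0,1\}$-valued process $(C(n))_{n\ge1}$, where $C(n)=1$ means that the $n$th record is read from $\mathbf R$ and $C(n)=0$ that it is read from $\mathbf S$, put $R(n)=\sum_{j=1}^nC(j)$, $S(n)=n-R(n)$ for $n\ge0$, and $$\mathcal F_n=\mathcal F_0\vee\sigma\bigl(L_{\mathbf R}(1),\dots,L_{\mathbf R}(R(n));\,L_{\mathbf S}(1),\dots,L_{\mathbf S}(S(n))\bigr),\qquad n\ge1.$$ The process $C$ is a reading policy if $C(n)$ is $\mathcal F_{n-1}$-measurable for every $n\ge1$. The number of matches among the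 first $n$ records read is $$M(n)=\sum_{i\ge1}\#\{j\le R(n):L_{\mathbf R}(j)=i\}\cdot\#\{k\le S(n):L_{\mathbf S}(k)=i\}.$$ Let $\sigma_{\mathbf R}^2$ be the variance of $s_{L_{\mathbf R}(1)}$ and $\sigma_{\mathbf S}^2$ the variance of $r_{L_{\mathbf S}(1)}$. Let $\alpha\in(0,1)$ and let $C$ be any reading policy such that $$\sqrt n\Bigl(\frac{R(n)}n-\alpha\Bigr)\to0\quad\text{almost surely},$$ or such that $\alpha=\tfrac12$ and $$n^{1/4}\Bigl(\frac{R(n)}n-\frac12\Bigr)\to0\quad\text{almost surely}.$$ Then, as $n\to\infty$, $$\sqrt n\left[\frac{M(n)}{\alpha(1-\alpha)n^2}-\mu\right]\xrightarrow{d}N\left(0,\ \frac{(1-\alpha)\sigma_{\mathbf R}^2+\alpha\sigma_{\mathbf S}^2}{\alpha(1-\alpha)}\right),$$ where $N(0,0)$ denotes the point mass at $0$. -/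

import Mathlib

open MeasureTheory ProbabilityTheory Filter Topology

namespace Equijoin

noncomputable section

/- Time is shifted by one: `LR j`, `LS j` are the labels of the `(j+1)`-st record of the sources
`R` and `S`, and `C j` is the source of the `(j+1)`-st selection. -/

/-- Every set of labels is measurable. -/
instance : MeasurableSpace ℕ+ := ⊤

/-- The labels of the two sources: `LR 0, LR 1, …, LS 0, LS 1, …` are mutually independent, a record
of `R` carries the label `i` with probability `r i`, a record of `S` with probability `s i`. -/
structure IsLabelModel {Ω : Type*} [MeasurableSpace Ω] (P : Measure Ω) (r s : PMF ℕ+)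
    (LR LS : ℕ → Ω → ℕ+) : Prop where
  measurable_LR : ∀ j, Measurable (LR j)
  measurable_LS : ∀ j, Measurable (LS j)
  law_LR : ∀ j i, P {ω | LR j ω = i} = r i
  law_LS : ∀ j i, P {ω | LS j ω = i} = s i
  indep : iIndepFun (Sum.elim LR LS) P

/-- The mean number of matches `μ = ∑ i, r i * s i` of one record of `R` with one of `S`. -/
def matchProb (r s : PMF ℕ+) : ℝ := ∑' i : ℕ+, (r i).toReal * (s i).toReal

/-- `X(j) = q_{L(j)}`, the probability that a record of the other source, whose label distribution
is `q`, matches the record with label `L j`. -/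
def matchVar {Ω : Type*} (q : PMF ℕ+) (L : ℕ → Ω → ℕ+) (j : ℕ) (ω : Ω) : ℝ := (q (L j ω)).toReal

/-- `N(k, i)`: how many of the first `k` records of a source carry the label `i`. -/
def labelCount {Ω : Type*} (L : ℕ → Ω → ℕ+) (k : ℕ) (i : ℕ+) (ω : Ω) : ℕ :=
  ∑ j ∈ Finset.range k, if L j ω = i then 1 else 0

/-- `R(n)`: how many of the first `n` selections are from the source `R` (`C j ω = true` means that
the selection is from `R`, `C j ω = false` that it is from `S`). -/
def readsR {Ω : Type*} (C : ℕ → Ω → Bool) (n : ℕ) (ω : Ω) : ℕ :=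
  ∑ j ∈ Finset.range n, (C j ω).toNat

theorem readsR_le {Ω : Type*} (C : ℕ → Ω → Bool) (n : ℕ) (ω : Ω) : readsR C n ω ≤ n := by
  simpa [readsR] using Finset.sum_le_card_nsmul (Finset.range n) (fun j => (C j ω).toNat) 1
    (fun j _ => Bool.toNat_le (C j ω))

/-- `S(n) = n - R(n)`; the subtraction does not truncate, by `readsR_le`. -/
def readsS {Ω : Type*} (C : ℕ → Ω → Bool) (n : ℕ) (ω : Ω) : ℕ := n - readsR C n ω

/-- `M(n)`: the number of matches among the first `n` records read, the inner product of the label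
counts of the two sources (only finitely many terms of the sum are nonzero). -/
def numMatches {Ω : Type*} (LR LS : ℕ → Ω → ℕ+) (C : ℕ → Ω → Bool) (n : ℕ) (ω : Ω) : ℕ :=
  ∑' i : ℕ+, labelCount LR (readsR C n ω) i ω * labelCount LS (readsS C n ω) i ω

/-- `σ(L(1), …, L(K))` for a random number `K` of records: the σ-algebra generated by the
variables that show the label of the `(j+1)`-st record if it is among the first `K`, and show
`none` otherwise. -/
abbrev readInfo {Ω : Type*} (L : ℕ → Ω → ℕ+) (K : Ω → ℕ) : MeasurableSpace Ω :=
  ⨆ j : ℕ, MeasurableSpace.comap (fun ω => if j < K ω then some (L j ω) else none) ⊤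

/-- `𝓕_n = 𝓕_0 ∨ σ(L_R(1), …, L_R(R(n)); L_S(1), …, L_S(S(n)))`: the information available after
the first `n` selections. -/
abbrev infoAt {Ω : Type*} (F₀ : MeasurableSpace Ω) (LR LS : ℕ → Ω → ℕ+) (C : ℕ → Ω → Bool) (n : ℕ) :
    MeasurableSpace Ω :=
  F₀ ⊔ (readInfo LR (readsR C n) ⊔ readInfo LS (readsS C n))

/-- `C` is a reading policy with external randomization `F₀`: `F₀` is independent of all labels,
and each selection is determined by the information available before it. -/
structure IsReadingPolicy {Ω : Type*} (F₀ : MeasurableSpace Ω) [mΩ : MeasurableSpace Ω]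
    (P : Measure Ω) (LR LS : ℕ → Ω → ℕ+) (C : ℕ → Ω → Bool) : Prop where
  le : F₀ ≤ mΩ
  indep : Indep F₀ ((⨆ j, MeasurableSpace.comap (LR j) ⊤) ⊔ (⨆ j, MeasurableSpace.comap (LS j) ⊤)) P
  predictable : ∀ n, Measurable[infoAt F₀ LR LS C n] (C n)

end

end Equijoin

/-! The match indicator has the Hoeffding decomposition 1{x = y} = μ + (s_x - μ) + (r_y - μ) +
`kernelDev r s x y`, whose last term has mean zero in each argument separately. Summed over all
pairs read (`cast_numMatches`), it splits M(n) into R(n)S(n)μ, two linear sums, weighted by S(n) and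
R(n), and a degenerate double sum.

The reads may depend on the labels, but almost surely R(n) is eventually within n^(3/4) of αn. A
union bound over this window (`tendstoInMeasure_of_eventually_mem`) therefore reduces every error
estimate to deterministic numbers of reads. For the linear sums, Hoeffding's inequality gives tails
exp(-c n^(1/4)), which beat the number of indices. For the degenerate sum, orthogonality and
Chebyshev give O(1/n) at each of O(n^(3/4)) indices.

With x = R(n)/n, the drift is √n (x(1-x) - α(1-α)) = (1-2α)√n (x-α) - √n (x-α)². The linear term
vanishes at α = 1/2, so the rate n^(1/4) suffices there. What remains is `linearPart`, two
independent i.i.d. sums of deterministic length, which obey the classical central limit theorem;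
Slutsky's theorem concludes. -/

/-! ### Degenerate kernel and tail bounds for deterministic numbers of reads -/

/-- A bounded function of two independent discrete random variables has mean zero if it has mean
zero given every value of the first one. -/
theorem ProbabilityTheory.IndepFun.integral_eq_zero_of_forall_integral_eq_zero
    {Ω E F : Type*} [MeasurableSpace Ω] {P : Measure Ω} [IsProbabilityMeasure P]
    [MeasurableSpace E] [DiscreteMeasurableSpace E] [Countable E]
    [MeasurableSpace F] [DiscreteMeasurableSpace F] [Countable F]
    {V : Ω → E} {Y : Ω → F} (hVY : IndepFun V Y P) (hV : Measurable V) (hY : Measurable Y)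
    (f : E → F → ℝ) (c : ℝ) (hc : ∀ v y, |f v y| ≤ c) (h0 : ∀ v, ∫ ω, f v (Y ω) ∂P = 0) :
    ∫ ω, f (V ω) (Y ω) ∂P = 0 := by
  have hmap := (indepFun_iff_map_prod_eq_prod_map_map hV.aemeasurable hY.aemeasurable).1 hVY
  have := Measure.isProbabilityMeasure_map (μ := P) hV.aemeasurable
  have := Measure.isProbabilityMeasure_map (μ := P) hY.aemeasurable
  have hf : Measurable (fun z : E × F => f z.1 z.2) := measurable_from_prod_countable_left fun _ => .of_discrete
  have h1 : ∫ ω, f (V ω) (Y ω) ∂P = ∫ z, f z.1 z.2 ∂(P.map fun ω => (V ω, Y ω)) :=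
    (integral_map (hV.prodMk hY).aemeasurable hf.aestronglyMeasurable).symm
  rw [h1, hmap, integral_prod]
  · have h2 : ∀ v, ∫ y, f v y ∂(P.map Y) = 0 := fun v => by
      rw [integral_map hY.aemeasurable (Measurable.of_discrete).aestronglyMeasurable, h0]
    simp [h2]
  · exact Integrable.of_bound hf.aestronglyMeasurable c (ae_of_all _ fun z => hc z.1 z.2)

namespace Equijoin

theorem toReal_mem_Icc (p : PMF ℕ+) (i : ℕ+) : (p i).toReal ∈ Set.Icc (0 : ℝ) 1 :=
  ⟨ENNReal.toReal_nonneg, ENNReal.toReal_le_of_le_ofReal zero_le_one (by simpa using p.coe_le_one i)⟩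

theorem matchProb_comm (r s : PMF ℕ+) : matchProb r s = matchProb s r :=
  tsum_congr fun _ => mul_comm _ _

/-- The degenerate kernel in the Hoeffding decomposition of the match indicator. -/
noncomputable def kernelDev (r s : PMF ℕ+) (x y : ℕ+) : ℝ :=
  (if x = y then 1 else 0) - (s x).toReal - (r y).toReal + matchProb r s

theorem kernelDev_comm (r s : PMF ℕ+) (x y : ℕ+) : kernelDev r s x y = kernelDev s r y x := by
  simp only [kernelDev, matchProb_comm r s, eq_comm (a := x)]
  ring

namespace IsLabelModel

variable {Ω : Type*} [MeasurableSpace Ω] {P : Measure Ω} {r s : PMF ℕ+} {LR LS : ℕ → Ω → ℕ+}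

theorem symm (h : IsLabelModel P r s LR LS) : IsLabelModel P s r LS LR where
  measurable_LR := h.measurable_LS
  measurable_LS := h.measurable_LR
  law_LR := h.law_LS
  law_LS := h.law_LR
  indep := by
    have := h.indep.precomp (g := Sum.swap) Sum.swap_leftInverse.injective
    convert! this using 1
    ext i
    rcases i with i | i <;> rfl

theorem map_LR (h : IsLabelModel P r s LR LS) (j : ℕ) : P.map (LR j) = r.toMeasure := by
  refine Measure.ext_of_singleton fun i => ?_
  rw [Measure.map_apply (h.measurable_LR j) (measurableSet_singleton i),
    PMF.toMeasure_apply_singleton _ _ (measurableSet_singleton i), ← h.law_LR j i]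
  rfl

theorem integral_LR (h : IsLabelModel P r s LR LS) (j : ℕ) (f : ℕ+ → ℝ) (c : ℝ)
    (hf : ∀ i, |f i| ≤ c) : ∫ ω, f (LR j ω) ∂P = ∑' i, (r i).toReal * f i := by
  have hm : Measurable f := .of_discrete
  rw [← integral_map (h.measurable_LR j).aemeasurable hm.aestronglyMeasurable, h.map_LR,
    PMF.integral_eq_tsum _ _ (Integrable.of_bound hm.aestronglyMeasurable c (ae_of_all _ hf))]
  rfl

theorem measurable_matchVar (h : IsLabelModel P r s LR LS) (q : PMF ℕ+) (j : ℕ) :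
    Measurable (matchVar q LR j) :=
  (Measurable.of_discrete (f := fun i => (q i).toReal)).comp (h.measurable_LR j)

theorem integral_matchVar (h : IsLabelModel P r s LR LS) (j : ℕ) :
    ∫ ω, matchVar s LR j ω ∂P = matchProb r s :=
  h.integral_LR j (fun i => (s i).toReal) 1 fun i => by
    rw [abs_of_nonneg (toReal_mem_Icc s i).1]; exact (toReal_mem_Icc s i).2

variable [IsProbabilityMeasure P]

theorem matchProb_mem_Icc (h : IsLabelModel P r s LR LS) : matchProb r s ∈ Set.Icc (0 : ℝ) 1 := by
  rw [← h.integral_matchVar 0]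
  refine ⟨integral_nonneg fun ω => (toReal_mem_Icc s _).1, ?_⟩
  have : ∫ ω, matchVar s LR 0 ω ∂P ≤ ∫ _, (1 : ℝ) ∂P :=
    integral_mono (Integrable.of_bound (h.measurable_matchVar s 0).aestronglyMeasurable 1
      (ae_of_all _ fun ω => by
        rw [matchVar, Real.norm_of_nonneg (toReal_mem_Icc s _).1]; exact (toReal_mem_Icc s _).2))
      (integrable_const _) fun ω => (toReal_mem_Icc s _).2
  simpa using this

theorem abs_kernelDev_le (h : IsLabelModel P r s LR LS) (x y : ℕ+) : |kernelDev r s x y| ≤ 2 := by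
  obtain ⟨h1, h2⟩ := toReal_mem_Icc s x
  obtain ⟨h3, h4⟩ := toReal_mem_Icc r y
  obtain ⟨h5, h6⟩ := h.matchProb_mem_Icc
  rw [kernelDev, abs_le]
  split_ifs <;> constructor <;> linarith

/-- Degeneracy: the indicator of `LR j = y` averages to `r y` and `s (LR j)` to μ, so all terms
cancel. -/
theorem integral_kernelDev_LR (h : IsLabelModel P r s LR LS) (j : ℕ) (y : ℕ+) :
    ∫ ω, kernelDev r s (LR j ω) y ∂P = 0 := by
  have hb (f : ℕ+ → ℝ) (c : ℝ) (hc : ∀ i, |f i| ≤ c) : Integrable (fun ω => f (LR j ω)) P :=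
    Integrable.of_bound ((Measurable.of_discrete (f := f)).comp
      (h.measurable_LR j)).aestronglyMeasurable c (ae_of_all _ fun ω => hc _)
  have hi1 : ∀ i : ℕ+, |(if i = y then 1 else 0 : ℝ)| ≤ 1 := fun i => by split_ifs <;> simp
  have hi2 : ∀ i : ℕ+, |(s i).toReal| ≤ 1 := fun i => by
    rw [abs_of_nonneg (toReal_mem_Icc s i).1]; exact (toReal_mem_Icc s i).2
  have e1 := h.integral_LR j (fun i => if i = y then 1 else 0) 1 hi1
  have e2 : ∫ ω, (s (LR j ω)).toReal ∂P = matchProb r s := h.integral_matchVar j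
  simp only [mul_ite, mul_one, mul_zero, tsum_ite_eq] at e1
  simp only [kernelDev]
  have i1 := hb _ 1 hi1
  have i2 := hb _ 1 hi2
  rw [integral_add (f := fun ω => (if LR j ω = y then 1 else 0) - (s (LR j ω)).toReal - (r y).toReal)
      ((i1.sub i2).sub (integrable_const _)) (integrable_const _),
    integral_sub (f := fun ω => (if LR j ω = y then 1 else 0) - (s (LR j ω)).toReal)
      (i1.sub i2) (integrable_const _), integral_sub i1 i2, e1, e2]
  simp

/-- With the other labels fixed, only the first factor involves `LR j`, and it averages to zero by
degeneracy. -/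
theorem integral_kernelDev_mul_of_left_ne (h : IsLabelModel P r s LR LS) {j j' : ℕ} (hj : j ≠ j')
    (m m' : ℕ) :
    ∫ ω, kernelDev r s (LR j ω) (LS m ω) * kernelDev r s (LR j' ω) (LS m' ω) ∂P = 0 := by
  let W : ℕ ⊕ ℕ → Ω → ℕ+ := Sum.elim LR LS
  have hW : ∀ i, Measurable (W i) := by
    rintro (i | i)
    exacts [h.measurable_LR i, h.measurable_LS i]
  -- The case `m = m'` is allowed; only `.inl j` has to lie outside `S`.
  let S : Finset (ℕ ⊕ ℕ) := {.inl j', .inr m, .inr m'}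
  let T : Finset (ℕ ⊕ ℕ) := {.inl j}
  have hφ : Measurable fun v : S → ℕ+ => (v ⟨.inl j', by simp [S]⟩, v ⟨.inr m, by simp [S]⟩,
      v ⟨.inr m', by simp [S]⟩) := by fun_prop
  have hψ : Measurable fun v : T → ℕ+ => v ⟨.inl j, by simp [T]⟩ := by fun_prop
  have hind := (h.indep.indepFun_finset S T (by simp [S, T, hj]) hW).comp hφ hψ
  refine hind.integral_eq_zero_of_forall_integral_eq_zero
    ((h.measurable_LR j').prodMk ((h.measurable_LS m).prodMk (h.measurable_LS m')))
    (h.measurable_LR j)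
    (fun v y => kernelDev r s y v.2.1 * kernelDev r s v.1 v.2.2) (2 * 2) ?_ ?_
  · intro v y
    rw [abs_mul]
    gcongr <;> exact h.abs_kernelDev_le _ _
  · intro v
    rw [integral_mul_const]
    exact mul_eq_zero_of_left (h.integral_kernelDev_LR j _) _

theorem integral_kernelDev_mul_of_right_ne (h : IsLabelModel P r s LR LS) (j j' : ℕ) {m m' : ℕ}
    (hm : m ≠ m') :
    ∫ ω, kernelDev r s (LR j ω) (LS m ω) * kernelDev r s (LR j' ω) (LS m' ω) ∂P = 0 := by
  simpa only [kernelDev_comm r s] using h.symm.integral_kernelDev_mul_of_left_ne hm j j'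

omit [IsProbabilityMeasure P] in
theorem measurable_kernelDev (h : IsLabelModel P r s LR LS) (j m : ℕ) :
    Measurable fun ω => kernelDev r s (LR j ω) (LS m ω) := by
  have hf : Measurable (fun z : ℕ+ × ℕ+ => kernelDev r s z.1 z.2) := .of_discrete
  exact hf.comp ((h.measurable_LR j).prodMk (h.measurable_LS m))

/-- Distinct pairs are orthogonal, so only the `k * l` diagonal terms survive, each at most 2² = 4.
-/
theorem integral_sum_kernelDev_sq_le (h : IsLabelModel P r s LR LS) (k l : ℕ) :
    ∫ ω, (∑ j ∈ Finset.range k, ∑ m ∈ Finset.range l, kernelDev r s (LR j ω) (LS m ω)) ^ 2 ∂P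
      ≤ 4 * (k * l) := by
  let g : ℕ × ℕ → Ω → ℝ := fun p ω => kernelDev r s (LR p.1 ω) (LS p.2 ω)
  have hg : ∀ p q, |∫ ω, g p ω * g q ω ∂P| ≤ 4 := fun p q => by
    have := norm_integral_le_of_norm_le_const (μ := P) (f := fun ω => g p ω * g q ω) (C := 4)
      (ae_of_all _ fun ω => by
        rw [Real.norm_eq_abs, abs_mul, show (4 : ℝ) = 2 * 2 by norm_num]
        gcongr <;> exact h.abs_kernelDev_le _ _)
    simpa using this
  have hi : ∀ p q, Integrable (fun ω => g p ω * g q ω) P := fun p q =>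
    Integrable.of_bound ((h.measurable_kernelDev p.1 p.2).mul
      (h.measurable_kernelDev q.1 q.2)).aestronglyMeasurable 4 (ae_of_all _ fun ω => by
        rw [Real.norm_eq_abs, abs_mul, show (4 : ℝ) = 2 * 2 by norm_num]
        gcongr <;> exact h.abs_kernelDev_le _ _)
  have h0 : ∀ p q, p ≠ q → ∫ ω, g p ω * g q ω ∂P = 0 := by
    rintro ⟨j, m⟩ ⟨j', m'⟩ hpq
    by_cases hj : j = j'
    · exact h.integral_kernelDev_mul_of_right_ne j j' (fun hm => hpq (Prod.ext hj hm))
    · exact h.integral_kernelDev_mul_of_left_ne hj m m'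
  simp_rw [← Finset.sum_product', sq, Finset.sum_mul_sum]
  rw [integral_finsetSum _ fun p _ => integrable_finsetSum _ fun q _ => hi p q]
  calc _ = ∑ p ∈ Finset.range k ×ˢ Finset.range l, ∫ ω, g p ω * g p ω ∂P := by
        refine Finset.sum_congr rfl fun p hp => ?_
        rw [integral_finsetSum _ fun q _ => hi p q, Finset.sum_eq_single p
          (fun q _ hq => h0 p q hq.symm) (fun hp' => absurd hp hp')]
    _ ≤ ∑ p ∈ Finset.range k ×ˢ Finset.range l, (4 : ℝ) :=
        Finset.sum_le_sum fun p _ => (le_abs_self _).trans (hg p p)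
    _ = 4 * (k * l) := by simp; ring

/-- Chebyshev's inequality for the degenerate part of the number of matches. -/
theorem measureReal_le_abs_mul_sum_kernelDev (h : IsLabelModel P r s LR LS) (k l : ℕ) (c : ℝ)
    {ε : ℝ} (hε : 0 < ε) :
    P.real {ω | ε ≤ |c * ∑ j ∈ Finset.range k, ∑ m ∈ Finset.range l,
      kernelDev r s (LR j ω) (LS m ω)|} ≤ 4 * c ^ 2 * (k * l) / ε ^ 2 := by
  let G : Ω → ℝ := fun ω => ∑ j ∈ Finset.range k, ∑ m ∈ Finset.range l,
    kernelDev r s (LR j ω) (LS m ω)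
  have hGm : Measurable G := Finset.measurable_fun_sum _ fun j _ =>
    Finset.measurable_fun_sum _ fun m _ => h.measurable_kernelDev j m
  have hGb : ∀ ω, |G ω| ≤ k * l * 2 := fun ω => by
    refine (Finset.abs_sum_le_sum_abs _ _).trans ?_
    calc _ ≤ ∑ j ∈ Finset.range k, ∑ m ∈ Finset.range l, (2 : ℝ) := Finset.sum_le_sum fun j _ =>
          (Finset.abs_sum_le_sum_abs _ _).trans (Finset.sum_le_sum fun m _ => h.abs_kernelDev_le _ _)
      _ = k * l * 2 := by simp; ring
  have hint : Integrable (fun ω => (c * G ω) ^ 2) P :=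
    Integrable.of_bound ((hGm.const_mul c).pow_const 2).aestronglyMeasurable
      ((|c| * (k * l * 2)) ^ 2) (ae_of_all _ fun ω => by
        rw [norm_pow, norm_mul, Real.norm_eq_abs, Real.norm_eq_abs]
        gcongr
        exact hGb ω)
  have hm := mul_meas_ge_le_integral_of_nonneg (μ := P) (f := fun ω => (c * G ω) ^ 2)
    (ae_of_all _ fun ω => sq_nonneg _) hint (ε ^ 2)
  have hset : {ω | ε ≤ |c * G ω|} = {ω | ε ^ 2 ≤ (c * G ω) ^ 2} := by
    ext ω
    rw [Set.mem_ofPred_eq, Set.mem_ofPred_eq, ← sq_abs (c * G ω),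
      pow_le_pow_iff_left₀ hε.le (abs_nonneg _) two_ne_zero]
  change P.real {ω | ε ≤ |c * G ω|} ≤ _
  rw [hset, le_div_iff₀ (by positivity), mul_comm]
  refine hm.trans ?_
  simp_rw [mul_pow]
  rw [integral_const_mul]
  calc _ ≤ c ^ 2 * (4 * (k * l)) := by gcongr; exact h.integral_sum_kernelDev_sq_le k l
    _ = _ := by ring

omit [IsProbabilityMeasure P] in
theorem iIndepFun_LR (h : IsLabelModel P r s LR LS) : iIndepFun LR P :=
  h.indep.precomp (g := Sum.inl) Sum.inl_injective

/-- Hoeffding's inequality for weighted sums of centered match probabilities. -/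
theorem measureReal_le_abs_mul_sum_matchVar (h : IsLabelModel P r s LR LS) (S : Finset ℕ) (c : ℝ)
    {v : ℝ} (hv0 : 0 ≤ v) (hv : c ^ 2 * S.card ≤ v) {ε : ℝ} (hε : 0 ≤ ε) :
    P.real {ω | ε ≤ |c * ∑ j ∈ S, (matchVar s LR j ω - matchProb r s)|}
      ≤ 2 * Real.exp (-ε ^ 2 / v) := by
  have hind : iIndepFun (fun j ω => matchVar s LR j ω - matchProb r s) P :=
    h.iIndepFun_LR.comp (fun _ i => (s i).toReal - matchProb r s) fun _ => .of_discrete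
  have hsub : ∀ j ∈ S, HasSubgaussianMGF (fun ω => matchVar s LR j ω - matchProb r s)
      ((‖(1 : ℝ) - 0‖₊ / 2) ^ 2) P := fun j _ => by
    have := hasSubgaussianMGF_of_mem_Icc (μ := P) (h.measurable_matchVar s j).aemeasurable
      (ae_of_all _ fun ω => toReal_mem_Icc s (LR j ω))
    rwa [h.integral_matchVar] at this
  have key : HasSubgaussianMGF (fun ω => c * ∑ j ∈ S, (matchVar s LR j ω - matchProb r s))
      (NNReal.mk (c ^ 2) (sq_nonneg c) * ∑ j ∈ S, (‖(1 : ℝ) - 0‖₊ / 2) ^ 2) P :=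
    (HasSubgaussianMGF.sum_of_iIndepFun hind hsub).const_mul c
  -- The variance proxy is c² · card / 4; the weaker `v / 2` turns the tail exp(-ε² / (2 · proxy))
  -- into exp(-ε² / v).
  have hK : NNReal.mk (c ^ 2) (sq_nonneg c) * ∑ j ∈ S, (‖(1 : ℝ) - 0‖₊ / 2) ^ 2
      ≤ NNReal.mk (v / 2) (by positivity) := by
    have h0 : 0 ≤ c ^ 2 * S.card := by positivity
    rw [← NNReal.coe_le_coe, NNReal.coe_mul, NNReal.coe_mk, NNReal.coe_mk]
    simp
    nlinarith
  have key' : HasSubgaussianMGF (fun ω => c * ∑ j ∈ S, (matchVar s LR j ω - matchProb r s))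
      (NNReal.mk (v / 2) (by positivity)) P :=
    ⟨key.integrable_exp_mul, fun t => (key.mgf_le t).trans (by gcongr)⟩
  have h1 := key'.measure_ge_le hε
  have h2 := key'.neg.measure_ge_le hε
  rw [NNReal.coe_mk, mul_div_cancel₀ v two_ne_zero] at h1 h2
  have hsub' : {ω | ε ≤ |c * ∑ j ∈ S, (matchVar s LR j ω - matchProb r s)|} ⊆
      {ω | ε ≤ c * ∑ j ∈ S, (matchVar s LR j ω - matchProb r s)} ∪
      {ω | ε ≤ (-fun ω => c * ∑ j ∈ S, (matchVar s LR j ω - matchProb r s)) ω} :=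
    fun ω hω => (le_abs.1 (show ε ≤ |_| from hω)).imp id id
  linarith [(measureReal_mono hsub').trans (measureReal_union_le (μ := P) _ _)]

end IsLabelModel
end Equijoin

/-! ### General facts on convergence in distribution and in probability -/

namespace MeasureTheory

theorem TendstoInDistribution.of_map_eq {ι E Ω' Ω'' : Type*} {Ω : ι → Type*}
    {m : ∀ i, MeasurableSpace (Ω i)} {μ : ∀ i, Measure (Ω i)} [∀ i, IsProbabilityMeasure (μ i)]
    {m' : MeasurableSpace Ω'} {μ' : Measure Ω'} [IsProbabilityMeasure μ']
    {m'' : MeasurableSpace Ω''} {μ'' : Measure Ω''} [IsProbabilityMeasure μ'']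
    [MeasurableSpace E] [TopologicalSpace E] [OpensMeasurableSpace E]
    {X : ∀ i, Ω i → E} {l : Filter ι} {Z : Ω' → E} {Z' : Ω'' → E}
    (h : TendstoInDistribution X l Z μ μ') (hZ' : AEMeasurable Z' μ'')
    (heq : μ'.map Z = μ''.map Z') : TendstoInDistribution X l Z' μ μ'' where
  forall_aemeasurable := h.forall_aemeasurable
  aemeasurable_limit := hZ'
  tendsto := by
    have : (⟨μ''.map Z', Measure.isProbabilityMeasure_map hZ'⟩ : ProbabilityMeasure E)
      = ⟨μ'.map Z, Measure.isProbabilityMeasure_map h.aemeasurable_limit⟩ := Subtype.ext heq.symm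
    rw [this]
    exact h.tendsto

variable {Ω : Type*} [MeasurableSpace Ω] {P : Measure Ω} [IsProbabilityMeasure P]

/-- By independence for each `n` the characteristic functions multiply; Lévy's continuity theorem
does the rest. -/
theorem TendstoInDistribution.add_gaussianReal {U V : ℕ → Ω → ℝ} {a b : NNReal}
    (hU : TendstoInDistribution U atTop (fun x : ℝ => x) (fun _ => P) (gaussianReal 0 a))
    (hV : TendstoInDistribution V atTop (fun x : ℝ => x) (fun _ => P) (gaussianReal 0 b))
    (hUV : ∀ n, IndepFun (U n) (V n) P) :
    TendstoInDistribution (fun n ω => U n ω + V n ω) atTop (fun x : ℝ => x) (fun _ => P)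
      (gaussianReal 0 (a + b)) where
  forall_aemeasurable n := (hU.forall_aemeasurable n).add (hV.forall_aemeasurable n)
  tendsto := by
    refine ProbabilityMeasure.tendsto_iff_tendsto_charFun.2 fun t => ?_
    have h1 := ProbabilityMeasure.tendsto_iff_tendsto_charFun.1 hU.tendsto t
    have h2 := ProbabilityMeasure.tendsto_iff_tendsto_charFun.1 hV.tendsto t
    simp only [ProbabilityMeasure.coe_mk, Measure.map_id', charFun_gaussianReal] at h1 h2 ⊢
    have h3 := h1.mul h2
    rw [← Complex.exp_add] at h3
    convert! h3 using 2
    · rw [(hUV _).charFun_map_fun_add_eq_mul (hU.forall_aemeasurable _) (hV.forall_aemeasurable _)]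
      rfl
    · push_cast
      ring_nf

omit [IsProbabilityMeasure P] in
theorem TendstoInMeasure.add_zero {ι : Type*} {l : Filter ι} {U V : ι → Ω → ℝ}
    (hU : TendstoInMeasure P U l 0) (hV : TendstoInMeasure P V l 0) :
    TendstoInMeasure P (fun n ω => U n ω + V n ω) l 0 := by
  rw [tendstoInMeasure_iff_norm] at hU hV ⊢
  intro ε hε
  refine tendsto_of_tendsto_of_tendsto_of_le_of_le tendsto_const_nhds
    (by simpa using (hU (ε / 2) (half_pos hε)).add (hV (ε / 2) (half_pos hε)))
    (fun _ => zero_le) fun n => ?_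
  refine (measure_mono fun ω hω => ?_).trans (measure_union_le _ _)
  by_contra hcon
  simp only [Set.mem_union, Set.mem_ofPred_eq, Pi.zero_apply, sub_zero, not_or, not_le] at hω hcon
  linarith [norm_add_le (U n ω) (V n ω), show ‖U n ω‖ < ε / 2 from hcon.1,
    show ‖V n ω‖ < ε / 2 from hcon.2]

/-- A union bound: if the index `K n` almost surely stays in the window `F n`, a family indexed by
the window that is uniformly small in probability is small at the random index `K n`. -/
theorem tendstoInMeasure_of_eventually_mem {V : ℕ → ℕ → Ω → ℝ} {K : ℕ → Ω → ℕ} (F : ℕ → Finset ℕ)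
    (hK : ∀ n, Measurable (K n)) (hF : ∀ᵐ ω ∂P, ∀ᶠ n in atTop, K n ω ∈ F n)
    (hV : ∀ ε > 0, Tendsto (fun n => ∑ k ∈ F n, P.real {ω | ε ≤ |V n k ω|}) atTop (𝓝 0)) :
    TendstoInMeasure P (fun n ω => V n (K n ω) ω) atTop 0 := by
  rw [tendstoInMeasure_iff_measureReal_norm]
  intro ε hε
  -- The indicators of these events vanish eventually almost surely, so dominated convergence
  -- applies.
  have hbad : Tendsto (fun n => P.real {ω | K n ω ∉ F n}) atTop (𝓝 0) := by
    have := tendsto_measure_of_ae_tendsto_indicator_of_isFiniteMeasure (μ := P) atTop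
      (A := ∅) (As := fun n => {ω | K n ω ∉ F n}) MeasurableSet.empty
      (fun n => hK n (MeasurableSet.of_discrete (s := {k | k ∉ F n}))) (by
        filter_upwards [hF] with ω hω
        filter_upwards [hω] with n hn
        simpa using hn)
    rw [measure_empty] at this
    exact (ENNReal.tendsto_toReal ENNReal.zero_ne_top).comp this
  refine squeeze_zero (fun n => measureReal_nonneg) (fun n => ?_)
    (by simpa using hbad.add (hV ε hε))
  have hsub : {ω | ε ≤ ‖V n (K n ω) ω - (0 : Ω → ℝ) ω‖} ⊆
      {ω | K n ω ∉ F n} ∪ ⋃ k ∈ F n, {ω | ε ≤ |V n k ω|} := fun ω hω => by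
    by_cases hk : K n ω ∈ F n
    · refine Or.inr (Set.mem_iUnion₂.2 ⟨K n ω, hk, ?_⟩)
      have h : ε ≤ ‖V n (K n ω) ω - 0‖ := hω
      rwa [sub_zero] at h
    · exact Or.inl hk
  refine (measureReal_mono hsub).trans ((measureReal_union_le _ _).trans ?_)
  gcongr
  exact measureReal_biUnion_finset_le _ _

end MeasureTheory

/-! ### Central limit theorem for one source, and the window around αn -/

namespace Equijoin

theorem IsLabelModel.tendstoInDistribution_mul_sum {Ω : Type*} [MeasurableSpace Ω] {P : Measure Ω}
    [IsProbabilityMeasure P] {r s : PMF ℕ+} {LR LS : ℕ → Ω → ℕ+} (h : IsLabelModel P r s LR LS)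
    {m : ℕ → ℕ} (hm : Tendsto m atTop atTop) {w : ℕ → ℝ} {c : ℝ}
    (hw : Tendsto (fun n => w n * √(m n : ℝ)) atTop (𝓝 c)) :
    TendstoInDistribution
      (fun n ω => w n * ∑ j ∈ Finset.range (m n), (matchVar s LR j ω - matchProb r s))
      atTop (fun x : ℝ => x) (fun _ => P)
      (gaussianReal 0 (NNReal.mk (c ^ 2) (sq_nonneg c)
        * (variance (matchVar s LR 0) P).toNNReal)) := by
  have hlp : MemLp (matchVar s LR 0) 2 P :=
    MemLp.of_bound (h.measurable_matchVar s 0).aestronglyMeasurable 1 (ae_of_all _ fun ω => by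
      rw [matchVar, Real.norm_of_nonneg (toReal_mem_Icc s _).1]; exact (toReal_mem_Icc s _).2)
  have hind : iIndepFun (matchVar s LR) P :=
    h.iIndepFun_LR.comp (fun _ i => (s i).toReal) fun _ => .of_discrete
  have hid : ∀ j, IdentDistrib (matchVar s LR j) (matchVar s LR 0) P P := fun j =>
    IdentDistrib.comp (u := fun i => (s i).toReal)
      ⟨(h.measurable_LR j).aemeasurable, (h.measurable_LR 0).aemeasurable, by simp only [h.map_LR]⟩
      .of_discrete
  have clt := tendstoInDistribution_inv_sqrt_mul_sum_sub (P' := gaussianReal 0 (variance (matchVar s LR 0) P).toNNReal)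
    (Y := fun x => x) HasLaw.id hlp hind hid
  have clt' : TendstoInDistribution
      (fun n ω => (√(m n : ℝ))⁻¹ * (∑ k ∈ Finset.range (m n), matchVar s LR k ω
        - (m n : ℕ) * ∫ ω, matchVar s LR 0 ω ∂P)) atTop (fun x : ℝ => x) (fun _ => P)
      (gaussianReal 0 (variance (matchVar s LR 0) P).toNNReal) :=
    ⟨fun n => clt.forall_aemeasurable (m n), clt.aemeasurable_limit, clt.tendsto.comp hm⟩
  have hY : TendstoInMeasure P (fun n (_ : Ω) => w n * √(m n : ℝ)) atTop (fun _ => c) :=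
    tendstoInMeasure_of_tendsto_ae (fun n => aestronglyMeasurable_const) (ae_of_all _ fun _ => hw)
  have key := clt'.continuous_comp_prodMk_of_tendstoInMeasure_const
    (g := fun z : ℝ × ℝ => z.2 * z.1) (by fun_prop) hY (fun n => aemeasurable_const)
  refine (key.congr (fun n => ae_of_all _ fun ω => ?_) .rfl).of_map_eq aemeasurable_id ?_
  · change w n * √(m n : ℝ) * _ = _
    rw [h.integral_matchVar, Finset.sum_sub_distrib, Finset.sum_const, Finset.card_range,
      nsmul_eq_mul]
    -- For `m n = 0` both sides vanish; otherwise √(m n) cancels its inverse.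
    rcases Nat.eq_zero_or_pos (m n) with h0 | h0
    · simp [h0]
    · have : √(m n : ℝ) ≠ 0 := by positivity
      field_simp
  · rw [gaussianReal_map_const_mul, Measure.map_id', mul_zero]

/-- In terms of u = n^(1/4) this is 2(u⁴ + 1)exp(-bu). -/
theorem tendsto_mul_exp_neg_rpow {b : ℝ} (hb : 0 < b) :
    Tendsto (fun n : ℕ => ((n : ℝ) + 1) * (2 * Real.exp (-b * (n : ℝ) ^ (1 / 4 : ℝ)))) atTop (𝓝 0) := by
  have h4 : Tendsto (fun n : ℕ => (n : ℝ) ^ (1 / 4 : ℝ)) atTop atTop :=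
    (tendsto_rpow_atTop (by norm_num)).comp tendsto_natCast_atTop_atTop
  have h1 := (tendsto_rpow_mul_exp_neg_mul_atTop_nhds_zero 4 b hb).comp h4
  have h2 := (tendsto_rpow_mul_exp_neg_mul_atTop_nhds_zero 0 b hb).comp h4
  have h3 := (h1.add h2).const_mul 2
  rw [add_zero, mul_zero] at h3
  refine h3.congr fun n => ?_
  simp only [Function.comp_apply]
  rw [← Real.rpow_mul (Nat.cast_nonneg n)]
  norm_num
  ring

/-- The numbers `k ≤ n` within distance `n ^ (3/4)` of `a n`. -/
noncomputable def window (a : ℝ) (n : ℕ) : Finset ℕ :=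
  (Finset.range (n + 1)).filter fun k => |(k : ℝ) - a * n| ≤ (n : ℝ) ^ (3 / 4 : ℝ)

theorem mem_window {a : ℝ} {n k : ℕ} :
    k ∈ window a n ↔ k ≤ n ∧ |(k : ℝ) - a * n| ≤ (n : ℝ) ^ (3 / 4 : ℝ) := by
  simp [window]

theorem card_window_le (a : ℝ) (n : ℕ) : ((window a n).card : ℝ) ≤ n + 1 := by
  exact_mod_cast (Finset.card_filter_le _ _).trans (Finset.card_range _).le

/-- The trivial bound n + 1 suffices against exponential tails; the O(1/n) Chebyshev tail needs this
sharper one. -/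
theorem card_window_le_rpow (a : ℝ) (n : ℕ) :
    ((window a n).card : ℝ) ≤ 2 * (n : ℝ) ^ (3 / 4 : ℝ) + 1 := by
  rcases (window a n).eq_empty_or_nonempty with h | h
  · rw [h]; simp; positivity
  · have hx := (mem_window.1 (Finset.min'_mem _ h)).2
    have hy := (mem_window.1 (Finset.max'_mem _ h)).2
    have hsub : window a n ⊆ Finset.Icc ((window a n).min' h) ((window a n).max' h) := fun k hk =>
      Finset.mem_Icc.2 ⟨Finset.min'_le _ _ hk, Finset.le_max' _ _ hk⟩
    have hle := Finset.min'_le_max' _ h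
    have hc := Finset.card_le_card hsub
    rw [Nat.card_Icc] at hc
    have hc' : ((window a n).card : ℝ) ≤ (window a n).max' h + 1 - (window a n).min' h := by
      rw [le_sub_iff_add_le]
      exact_mod_cast (by omega)
    rw [abs_le] at hx hy
    linarith [hx.1, hy.2]

end Equijoin

/-! ### Decomposition of M(n) and measurability -/

namespace Equijoin

theorem tsum_ite_eq_mul_ite_eq (x y : ℕ+) :
    ∑' i : ℕ+, (if x = i then 1 else 0) * (if y = i then 1 else 0) = if x = y then 1 else 0 := by
  rw [tsum_eq_single x fun i hi => by simp [hi.symm]]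
  simp [eq_comm]

theorem tsum_labelCount_mul {Ω : Type*} (LR LS : ℕ → Ω → ℕ+) (k l : ℕ) (ω : Ω) :
    ∑' i : ℕ+, labelCount LR k i ω * labelCount LS l i ω
      = ∑ j ∈ Finset.range k, ∑ m ∈ Finset.range l, if LR j ω = LS m ω then 1 else 0 := by
  have hs : ∀ j m, Summable fun i : ℕ+ =>
      (if LR j ω = i then 1 else 0) * (if LS m ω = i then 1 else 0) := fun j m =>
    summable_of_hasFiniteSupport ((Set.finite_singleton (LR j ω)).subset fun i hi => by
      by_contra h
      exact hi (mul_eq_zero_of_left (if_neg fun h' => h h'.symm) _))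
  simp only [labelCount, Finset.sum_mul_sum]
  rw [Summable.tsum_finsetSum fun j _ => summable_sum fun m _ => hs j m]
  refine Finset.sum_congr rfl fun j _ => ?_
  rw [Summable.tsum_finsetSum fun m _ => hs j m]
  exact Finset.sum_congr rfl fun m _ => tsum_ite_eq_mul_ite_eq _ _

theorem cast_numMatches {Ω : Type*} (r s : PMF ℕ+) (LR LS : ℕ → Ω → ℕ+) (C : ℕ → Ω → Bool) (n : ℕ)
    (ω : Ω) :
    (numMatches LR LS C n ω : ℝ) = (readsR C n ω : ℝ) * (readsS C n ω : ℝ) * matchProb r s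
      + readsS C n ω * ∑ j ∈ Finset.range (readsR C n ω), (matchVar s LR j ω - matchProb r s)
      + readsR C n ω * ∑ m ∈ Finset.range (readsS C n ω), (matchVar r LS m ω - matchProb s r)
      + ∑ j ∈ Finset.range (readsR C n ω), ∑ m ∈ Finset.range (readsS C n ω),
        kernelDev r s (LR j ω) (LS m ω) := by
  rw [numMatches, tsum_labelCount_mul]
  simp only [kernelDev, matchVar, matchProb_comm s r, Finset.sum_add_distrib,
    Finset.sum_sub_distrib, Finset.sum_const, Finset.card_range, nsmul_eq_mul, ← Finset.mul_sum]
  push_cast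
  ring

theorem measurable_comp_index {Ω : Type*} [MeasurableSpace Ω] {f : ℕ → Ω → ℕ} {K : Ω → ℕ}
    (hf : ∀ k, Measurable (f k)) (hK : Measurable K) : Measurable fun ω => f (K ω) ω :=
  (measurable_from_prod_countable_right (f := fun z : ℕ × Ω => f z.1 z.2) hf).comp
    (hK.prodMk measurable_id)

theorem measurable_readsR {Ω : Type*} [MeasurableSpace Ω] {C : ℕ → Ω → Bool} {n : ℕ}
    (hC : ∀ j < n, Measurable (C j)) : Measurable (readsR C n) :=
  Finset.measurable_fun_sum _ fun j hj =>
    (Measurable.of_discrete (f := Bool.toNat)).comp (hC j (Finset.mem_range.1 hj))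

theorem readInfo_le {Ω : Type*} [mΩ : MeasurableSpace Ω] {L : ℕ → Ω → ℕ+} {K : Ω → ℕ}
    (hL : ∀ j, Measurable (L j)) (hK : Measurable K) : readInfo L K ≤ mΩ := by
  let _ : MeasurableSpace (Option ℕ+) := ⊤
  refine iSup_le fun j => Measurable.comap_le ?_
  exact Measurable.ite (hK (MeasurableSet.of_discrete (s := {k | j < k})))
    ((measurable_from_top (f := Option.some)).comp (hL j)) measurable_const

/-- Strong induction is needed because `infoAt` at time `n` is known to lie below the ambient
σ-algebra only once the earlier selections are measurable. -/
theorem IsReadingPolicy.measurable {Ω : Type*} {F₀ : MeasurableSpace Ω} [mΩ : MeasurableSpace Ω]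
    {P : Measure Ω} {r s : PMF ℕ+} {LR LS : ℕ → Ω → ℕ+} {C : ℕ → Ω → Bool}
    (hL : IsLabelModel P r s LR LS) (hC : IsReadingPolicy F₀ P LR LS C) (n : ℕ) :
    Measurable (C n) := by
  induction n using Nat.strong_induction_on with
  | _ n ih =>
    have hR := measurable_readsR ih
    have hS : Measurable (readsS C n) := measurable_const.sub hR
    exact (hC.predictable n).mono (sup_le hC.le (sup_le (readInfo_le hL.measurable_LR hR)
      (readInfo_le hL.measurable_LS hS))) le_rfl

theorem measurable_numMatches {Ω : Type*} [MeasurableSpace Ω] {LR LS : ℕ → Ω → ℕ+}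
    {C : ℕ → Ω → Bool} (hR : ∀ j, Measurable (LR j)) (hS : ∀ j, Measurable (LS j))
    (hC : ∀ n, Measurable (C n)) (n : ℕ) : Measurable (numMatches LR LS C n) := by
  have h : ∀ k, Measurable fun ω => ∑ j ∈ Finset.range k, ∑ m ∈ Finset.range (n - k),
      if LR j ω = LS m ω then 1 else 0 := fun k =>
    Finset.measurable_fun_sum _ fun j _ => Finset.measurable_fun_sum _ fun m _ =>
      (Measurable.of_discrete (f := fun z : ℕ+ × ℕ+ => if z.1 = z.2 then 1 else 0)).comp
        ((hR j).prodMk (hS m))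
  have := measurable_comp_index h (measurable_readsR (n := n) fun j _ => hC j)
  convert! this using 1
  funext ω
  exact tsum_labelCount_mul LR LS _ _ ω

/-! ### Deterministic limits along a path of R(n)/n -/

section Deterministic

variable {a : ℝ} {x : ℕ → ℝ}

theorem tendsto_rpow_quarter_mul
    (h : Tendsto (fun n : ℕ => √(n : ℝ) * (x n - a)) atTop (𝓝 0)) :
    Tendsto (fun n : ℕ => (n : ℝ) ^ (1 / 4 : ℝ) * (x n - a)) atTop (𝓝 0) := by
  refine squeeze_zero_norm' ?_ (by simpa using h.norm)
  filter_upwards [eventually_ge_atTop 1] with n hn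
  have h1 : (1 : ℝ) ≤ n := by exact_mod_cast hn
  simp only [Real.norm_eq_abs, abs_mul]
  rw [abs_of_nonneg (Real.sqrt_nonneg _), abs_of_nonneg (Real.rpow_nonneg (Nat.cast_nonneg n) _), Real.sqrt_eq_rpow]
  gcongr
  norm_num

theorem tendsto_sqrt_mul_sq (h : Tendsto (fun n : ℕ => (n : ℝ) ^ (1 / 4 : ℝ) * (x n - a)) atTop (𝓝 0)) :
    Tendsto (fun n : ℕ => √(n : ℝ) * (x n - a) ^ 2) atTop (𝓝 0) := by
  have := h.pow 2
  rw [zero_pow two_ne_zero] at this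
  refine this.congr fun n => ?_
  rw [mul_pow, ← Real.rpow_mul_natCast (Nat.cast_nonneg n), Real.sqrt_eq_rpow]
  norm_num

/-- Uses x(1-x) - a(1-a) = (1-2a)(x-a) - (x-a)². -/
theorem tendsto_sqrt_mul_product (h : Tendsto (fun n : ℕ => √(n : ℝ) * (x n - a)) atTop (𝓝 0)) :
    Tendsto (fun n : ℕ => √(n : ℝ) * (x n * (1 - x n) - a * (1 - a))) atTop (𝓝 0) := by
  have := (h.mul_const (1 - 2 * a)).sub (tendsto_sqrt_mul_sq (tendsto_rpow_quarter_mul h))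
  rw [zero_mul, sub_zero] at this
  exact this.congr fun n => by ring

/-- At a = 1/2 the first-order coefficient 1 - 2a is zero and only the square remains. -/
theorem tendsto_sqrt_mul_product_half
    (h : Tendsto (fun n : ℕ => (n : ℝ) ^ (1 / 4 : ℝ) * (x n - 1 / 2)) atTop (𝓝 0)) :
    Tendsto (fun n : ℕ => √(n : ℝ) * (x n * (1 - x n) - 1 / 2 * (1 - 1 / 2))) atTop (𝓝 0) := by
  have := (tendsto_sqrt_mul_sq h).neg
  rw [neg_zero] at this
  exact this.congr fun n => by ring

theorem eventually_mem_window {k : ℕ → ℕ} (hk : ∀ n, k n ≤ n)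
    (h : Tendsto (fun n : ℕ => (n : ℝ) ^ (1 / 4 : ℝ) * ((k n : ℝ) / n - a)) atTop (𝓝 0)) :
    ∀ᶠ n in atTop, k n ∈ window a n := by
  have h1 := h.norm
  rw [norm_zero] at h1
  filter_upwards [h1.eventually_le_const zero_lt_one, eventually_ge_atTop 1] with n hn hn1
  have h0 : (0 : ℝ) < n := by exact_mod_cast hn1
  refine mem_window.2 ⟨hk n, ?_⟩
  have e : (k n : ℝ) - a * n = (n : ℝ) ^ (3 / 4 : ℝ) * ((n : ℝ) ^ (1 / 4 : ℝ) * ((k n : ℝ) / n - a)) := by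
    rw [← mul_assoc, ← Real.rpow_add h0]
    norm_num
    field_simp
  rw [e, abs_mul, abs_of_nonneg (by positivity)]
  exact mul_le_of_le_one_right (by positivity) hn

end Deterministic

/-! ### Remainders that vanish in probability -/

section Remainders

variable {Ω : Type*} [MeasurableSpace Ω] {P : Measure Ω} [IsProbabilityMeasure P] {r s : PMF ℕ+}
  {LR LS : ℕ → Ω → ℕ+}

/-- Hypothesis `hc` bounds the variance of each term by O(n^(-1/4)), so Hoeffding's tail survives
summation over at most n + 1 indices. It covers both a change of length and, with `g = 0`, a change
of coefficient. -/
theorem IsLabelModel.tendstoInMeasure_mul_sum_sub_sum (h : IsLabelModel P r s LR LS) {a : ℝ}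
    {K : ℕ → Ω → ℕ} (hK : ∀ n, Measurable (K n))
    (hKw : ∀ᵐ ω ∂P, ∀ᶠ n in atTop, K n ω ∈ window a n)
    (c : ℕ → ℕ → ℝ) (f g : ℕ → ℕ → ℕ) {B : ℝ} (hB : 0 < B)
    (hc : ∀ n ≥ 1, ∀ k ∈ window a n,
      c n k ^ 2 * |(f n k : ℝ) - g n k| ≤ B / (n : ℝ) ^ (1 / 4 : ℝ)) :
    TendstoInMeasure P (fun n ω => c n (K n ω) *
      (∑ j ∈ Finset.range (f n (K n ω)), (matchVar s LR j ω - matchProb r s)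
        - ∑ j ∈ Finset.range (g n (K n ω)), (matchVar s LR j ω - matchProb r s))) atTop 0 := by
  refine tendstoInMeasure_of_eventually_mem (V := fun n k ω => c n k *
      (∑ j ∈ Finset.range (f n k), (matchVar s LR j ω - matchProb r s)
        - ∑ j ∈ Finset.range (g n k), (matchVar s LR j ω - matchProb r s)))
    (window a) hK hKw fun ε hε => ?_
  refine squeeze_zero' (Eventually.of_forall fun n => Finset.sum_nonneg fun k _ => measureReal_nonneg)
    ?_ (tendsto_mul_exp_neg_rpow (b := ε ^ 2 / B) (by positivity))
  filter_upwards [eventually_ge_atTop 1] with n hn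
  have hn0 : (0 : ℝ) < n := by exact_mod_cast hn
  have hterm : ∀ k ∈ window a n, P.real {ω | ε ≤ |c n k *
      (∑ j ∈ Finset.range (f n k), (matchVar s LR j ω - matchProb r s)
        - ∑ j ∈ Finset.range (g n k), (matchVar s LR j ω - matchProb r s))|}
      ≤ 2 * Real.exp (-(ε ^ 2 / B) * (n : ℝ) ^ (1 / 4 : ℝ)) := fun k hk => by
    have hv := hc n hn k hk
    have e : -(ε ^ 2 / B) * (n : ℝ) ^ (1 / 4 : ℝ) = -ε ^ 2 / (B / (n : ℝ) ^ (1 / 4 : ℝ)) := by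
      field_simp
    rw [e]
    -- Either way the difference is, up to sign, a sum over the interval between the two lengths.
    rcases le_total (g n k) (f n k) with hfg | hfg
    · simp_rw [← Finset.sum_Ico_eq_sub _ hfg]
      refine h.measureReal_le_abs_mul_sum_matchVar _ _ (by positivity) ?_ hε.le
      rwa [Nat.card_Ico, Nat.cast_sub hfg,
        ← abs_of_nonneg (sub_nonneg.2 (Nat.cast_le (α := ℝ).2 hfg))]
    · simp_rw [abs_mul, abs_sub_comm (∑ j ∈ Finset.range (f n k), _), ← abs_mul,
        ← Finset.sum_Ico_eq_sub _ hfg]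
      refine h.measureReal_le_abs_mul_sum_matchVar _ _ (by positivity) ?_ hε.le
      rwa [Nat.card_Ico, Nat.cast_sub hfg,
        ← abs_of_nonneg (sub_nonneg.2 (Nat.cast_le (α := ℝ).2 hfg)), abs_sub_comm]
  refine (Finset.sum_le_card_nsmul _ _ _ hterm).trans ?_
  rw [nsmul_eq_mul]
  gcongr
  exact card_window_le a n

theorem IsLabelModel.tendstoInMeasure_mul_sum_kernelDev (h : IsLabelModel P r s LR LS) {a : ℝ}
    {K : ℕ → Ω → ℕ} (hK : ∀ n, Measurable (K n))
    (hKw : ∀ᵐ ω ∂P, ∀ᶠ n in atTop, K n ω ∈ window a n) (b : ℝ) :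
    TendstoInMeasure P (fun (n : ℕ) ω => √(n : ℝ) / (b * (n : ℝ) ^ 2) *
      ∑ j ∈ Finset.range (K n ω), ∑ m ∈ Finset.range (n - K n ω),
        kernelDev r s (LR j ω) (LS m ω)) atTop 0 := by
  refine tendstoInMeasure_of_eventually_mem (V := fun n k ω => √(n : ℝ) / (b * (n : ℝ) ^ 2) *
      ∑ j ∈ Finset.range k, ∑ m ∈ Finset.range (n - k), kernelDev r s (LR j ω) (LS m ω))
    (window a) hK hKw fun ε hε => ?_
  -- 12 = 3 · 4: at most 3n^(3/4) indices, each with Chebyshev bound 4(b⁻¹/ε)²/n.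
  have h0 : Tendsto (fun n : ℕ => 12 * (b⁻¹ / ε) ^ 2 * (n : ℝ) ^ (-(1 / 4) : ℝ)) atTop (𝓝 0) := by
    have := ((tendsto_rpow_neg_atTop (y := 1 / 4) (by norm_num)).comp
      tendsto_natCast_atTop_atTop).const_mul (12 * (b⁻¹ / ε) ^ 2)
    rwa [mul_zero] at this
  refine squeeze_zero' (Eventually.of_forall fun n => Finset.sum_nonneg fun k _ => measureReal_nonneg)
    ?_ h0
  filter_upwards [eventually_ge_atTop 1] with n hn
  have hn1 : (1 : ℝ) ≤ n := by exact_mod_cast hn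
  have hn0 : (0 : ℝ) < n := by linarith
  have hterm : ∀ k ∈ window a n, P.real {ω | ε ≤ |√(n : ℝ) / (b * (n : ℝ) ^ 2) *
      ∑ j ∈ Finset.range k, ∑ m ∈ Finset.range (n - k), kernelDev r s (LR j ω) (LS m ω)|}
      ≤ 4 * (b⁻¹ / ε) ^ 2 / n := fun k hk => by
    refine (h.measureReal_le_abs_mul_sum_kernelDev _ _ _ hε).trans ?_
    have hkn := (mem_window.1 hk).1
    have hkl : (k : ℝ) * ((n - k : ℕ) : ℝ) ≤ n * n := by
      gcongr
      exact Nat.sub_le _ _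
    calc _ ≤ 4 * (√(n : ℝ) / (b * (n : ℝ) ^ 2)) ^ 2 * (n * n) / ε ^ 2 := by gcongr
      _ = _ := by
        rw [div_pow, Real.sq_sqrt hn0.le]
        field_simp
  refine (Finset.sum_le_card_nsmul _ _ _ hterm).trans ?_
  rw [nsmul_eq_mul]
  have hcard : ((window a n).card : ℝ) ≤ 3 * (n : ℝ) ^ (3 / 4 : ℝ) := by
    have := Real.one_le_rpow hn1 (z := 3 / 4) (by norm_num)
    linarith [card_window_le_rpow a n]
  calc _ ≤ 3 * (n : ℝ) ^ (3 / 4 : ℝ) * (4 * (b⁻¹ / ε) ^ 2 / n) := by gcongr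
    _ = 12 * (b⁻¹ / ε) ^ 2 * ((n : ℝ) ^ (3 / 4 : ℝ) / n) := by ring
    _ = _ := by
      congr 1
      rw [← Real.rpow_sub_one hn0.ne']
      norm_num

end Remainders

end Equijoin

/-! ### Gaussian limit of the linear part -/

namespace Equijoin

section Limit

variable {Ω : Type*} [MeasurableSpace Ω] {P : Measure Ω} [IsProbabilityMeasure P] {r s : PMF ℕ+}
  {LR LS : ℕ → Ω → ℕ+}

/-- The linear part of the normalized number of matches, when the `n` records are split
deterministically in proportions `α` and `1 - α`. -/
noncomputable def linearPart {Ω : Type*} (r s : PMF ℕ+) (LR LS : ℕ → Ω → ℕ+) (α : ℝ) (n : ℕ)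
    (ω : Ω) : ℝ :=
  1 / (α * √(n : ℝ)) * ∑ j ∈ Finset.range ⌊α * n⌋₊, (matchVar s LR j ω - matchProb r s)
    + 1 / ((1 - α) * √(n : ℝ)) *
      ∑ m ∈ Finset.range (n - ⌊α * n⌋₊), (matchVar r LS m ω - matchProb s r)

theorem tendsto_div_sqrt_mul_sqrt {m : ℕ → ℕ} {a : ℝ} (ha : 0 < a)
    (h : Tendsto (fun n => (m n : ℝ) / n) atTop (𝓝 a)) :
    Tendsto (fun n : ℕ => 1 / (a * √(n : ℝ)) * √(m n : ℝ)) atTop (𝓝 (√a / a)) := by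
  refine (h.sqrt.div_const a).congr fun n => ?_
  rw [Real.sqrt_div (Nat.cast_nonneg _)]
  rcases eq_or_ne (√(n : ℝ)) 0 with h0 | h0
  · simp [h0]
  · field_simp

theorem tendsto_atTop_of_tendsto_div {m : ℕ → ℕ} {a : ℝ} (ha : 0 < a)
    (h : Tendsto (fun n => (m n : ℝ) / n) atTop (𝓝 a)) : Tendsto m atTop atTop := by
  refine tendsto_natCast_atTop_iff.1 ((h.pos_mul_atTop ha
    (tendsto_natCast_atTop_atTop (R := ℝ))).congr' ?_)
  filter_upwards [eventually_ge_atTop 1] with n hn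
  have : (0 : ℝ) < n := by exact_mod_cast hn
  field_simp

theorem floor_mul_le {α : ℝ} (hα : α ∈ Set.Ioo (0 : ℝ) 1) (n : ℕ) : ⌊α * n⌋₊ ≤ n :=
  Nat.floor_le_of_le (mul_le_of_le_one_left (Nat.cast_nonneg n) hα.2.le)

omit [IsProbabilityMeasure P] in
theorem IsLabelModel.indepFun_sum (h : IsLabelModel P r s LR LS) (k l : ℕ) (c d : ℝ) :
    IndepFun (fun ω => c * ∑ j ∈ Finset.range k, (matchVar s LR j ω - matchProb r s))
      (fun ω => d * ∑ m ∈ Finset.range l, (matchVar r LS m ω - matchProb s r)) P := by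
  have hm : ∀ i, Measurable (Sum.elim LR LS i) := by
    rintro (i | i)
    exacts [h.measurable_LR i, h.measurable_LS i]
  let S : Finset (ℕ ⊕ ℕ) := (Finset.range k).map ⟨Sum.inl, Sum.inl_injective⟩
  let T : Finset (ℕ ⊕ ℕ) := (Finset.range l).map ⟨Sum.inr, Sum.inr_injective⟩
  have hST : Disjoint S T := by
    rw [Finset.disjoint_left]
    intro i hi hi'
    simp only [S, T, Finset.mem_map, Function.Embedding.coeFn_mk] at hi hi'
    obtain ⟨j, -, rfl⟩ := hi
    obtain ⟨m, -, hm⟩ := hi'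
    cases hm
  have hφ : Measurable fun v : S → ℕ+ => c * ∑ j : S, ((s (v j)).toReal - matchProb r s) :=
    .of_discrete
  have hψ : Measurable fun v : T → ℕ+ => d * ∑ j : T, ((r (v j)).toReal - matchProb s r) :=
    .of_discrete
  have hind := (h.indep.indepFun_finset S T hST hm).comp hφ hψ
  convert! hind using 1
  · funext ω
    simp only [Function.comp_apply]
    rw [Finset.sum_coe_sort S (fun i => (s (Sum.elim LR LS i ω)).toReal - matchProb r s),
      Finset.sum_map]
    rfl
  · funext ω
    simp only [Function.comp_apply]
    rw [Finset.sum_coe_sort T (fun i => (r (Sum.elim LR LS i ω)).toReal - matchProb s r),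
      Finset.sum_map]
    rfl

theorem IsLabelModel.tendstoInDistribution_linearPart (h : IsLabelModel P r s LR LS) {α : ℝ}
    (hα : α ∈ Set.Ioo (0 : ℝ) 1) :
    TendstoInDistribution (linearPart r s LR LS α) atTop (fun x : ℝ => x) (fun _ => P)
      (gaussianReal 0 (Real.toNNReal (((1 - α) * variance (matchVar s LR 0) P
        + α * variance (matchVar r LS 0) P) / (α * (1 - α))))) := by
  obtain ⟨h0, h1⟩ := hα
  have h1' : 0 < 1 - α := sub_pos.2 h1
  have hm : Tendsto (fun n : ℕ => (⌊α * n⌋₊ : ℝ) / n) atTop (𝓝 α) :=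
    (tendsto_nat_floor_mul_div_atTop h0.le).comp tendsto_natCast_atTop_atTop
  have hm' : Tendsto (fun n : ℕ => ((n - ⌊α * n⌋₊ : ℕ) : ℝ) / n) atTop (𝓝 (1 - α)) := by
    refine (hm.const_sub 1).congr' ?_
    filter_upwards [eventually_ge_atTop 1] with n hn
    have : (0 : ℝ) < n := by exact_mod_cast hn
    rw [Nat.cast_sub (floor_mul_le ⟨h0, h1⟩ n)]
    field_simp
  have key := (h.tendstoInDistribution_mul_sum (tendsto_atTop_of_tendsto_div h0 hm)
    (tendsto_div_sqrt_mul_sqrt h0 hm)).add_gaussianReal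
    (h.symm.tendstoInDistribution_mul_sum (tendsto_atTop_of_tendsto_div h1' hm')
      (tendsto_div_sqrt_mul_sqrt h1' hm')) fun n => h.indepFun_sum _ _ _ _
  convert! key using 2
  -- The two sources contribute σ_R²/α and σ_S²/(1-α), as (√a/a)² = 1/a.
  refine NNReal.coe_injective ?_
  have hv1 := variance_nonneg (matchVar s LR 0) P
  have hv2 := variance_nonneg (matchVar r LS 0) P
  rw [Real.coe_toNNReal _ (by positivity), NNReal.coe_add, NNReal.coe_mul, NNReal.coe_mul,
    NNReal.coe_mk, NNReal.coe_mk, Real.coe_toNNReal _ hv1, Real.coe_toNNReal _ hv2, div_pow, div_pow,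
    Real.sq_sqrt h0.le, Real.sq_sqrt h1'.le]
  field_simp

end Limit

/-! ### Variance bounds for the replacement errors -/

theorem abs_sub_floor_le {α : ℝ} (hα : α ∈ Set.Ioo (0 : ℝ) 1) {n k : ℕ} (hn : 1 ≤ n)
    (hk : k ∈ window α n) : |(k : ℝ) - ⌊α * n⌋₊| ≤ 2 * (n : ℝ) ^ (3 / 4 : ℝ) := by
  have hn1 : (1 : ℝ) ≤ n := by exact_mod_cast hn
  have h1 := Real.one_le_rpow hn1 (z := 3 / 4) (by norm_num)
  have h2 := abs_le.1 (mem_window.1 hk).2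
  have h3 := Nat.floor_le (a := α * n) (by have := hα.1; positivity)
  have h4 := Nat.lt_floor_add_one (α * n)
  rw [abs_le]
  constructor <;> linarith [h2.1, h2.2]

/-- For a change of length: the coefficient is O(n^(-1/2)) and the lengths differ by O(n^(3/4)). -/
theorem coeff_sq_mul_abs_le {n : ℕ} (hn : 1 ≤ n) {x b d : ℝ} (hx : |x| ≤ 1)
    (hd : |d| ≤ 2 * (n : ℝ) ^ (3 / 4 : ℝ)) :
    (x / (b * √(n : ℝ))) ^ 2 * |d| ≤ 2 / b ^ 2 / (n : ℝ) ^ (1 / 4 : ℝ) := by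
  have hn0 : (0 : ℝ) < n := by exact_mod_cast hn
  have hx2 : x ^ 2 ≤ 1 := by rw [← sq_abs]; exact pow_le_one₀ (abs_nonneg _) hx
  rw [div_pow, mul_pow, Real.sq_sqrt hn0.le]
  calc x ^ 2 / (b ^ 2 * n) * |d| ≤ 1 / (b ^ 2 * n) * (2 * (n : ℝ) ^ (3 / 4 : ℝ)) := by gcongr
    _ = 2 / b ^ 2 * ((n : ℝ) ^ (3 / 4 : ℝ) / n) := by ring
    _ = 2 / b ^ 2 / (n : ℝ) ^ (1 / 4 : ℝ) := by
      rw [div_eq_mul_inv _ ((n : ℝ) ^ (1 / 4 : ℝ)), ← Real.rpow_neg hn0.le,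
        ← Real.rpow_sub_one hn0.ne']
      norm_num

/-- For a change of coefficient: the length may be as large as n, but |k/n - α| ≤ n^(-1/4)
compensates. The bound is relaxed so that all replacements share one constant. -/
theorem deviation_sq_mul_abs_le {α : ℝ} {n k : ℕ} (hn : 1 ≤ n) (hk : k ∈ window α n) {b d : ℝ}
    (hd : |d| ≤ n) :
    (((k : ℝ) / n - α) / (b * √(n : ℝ))) ^ 2 * |d| ≤ 2 / b ^ 2 / (n : ℝ) ^ (1 / 4 : ℝ) := by
  have hn1 : (1 : ℝ) ≤ n := by exact_mod_cast hn
  have hn0 : (0 : ℝ) < n := by linarith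
  have hq : (0 : ℝ) < (n : ℝ) ^ (1 / 4 : ℝ) := by positivity
  have hx : |(k : ℝ) / n - α| ≤ 1 / (n : ℝ) ^ (1 / 4 : ℝ) := by
    have e : (k : ℝ) / n - α = (k - α * n) / n := by field_simp
    rw [e, abs_div, abs_of_pos hn0, div_le_div_iff₀ hn0 hq]
    refine (mul_le_mul_of_nonneg_right (mem_window.1 hk).2 hq.le).trans_eq ?_
    rw [← Real.rpow_add hn0]
    norm_num
  have hx2 : ((k : ℝ) / n - α) ^ 2 ≤ 1 / (n : ℝ) ^ (1 / 4 : ℝ) := by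
    rw [← sq_abs]
    refine (pow_le_pow_left₀ (abs_nonneg _) hx 2).trans (pow_le_of_le_one (by positivity) ?_ two_ne_zero)
    exact (div_le_one hq).2 (Real.one_le_rpow hn1 (by norm_num))
  rw [div_pow, mul_pow, Real.sq_sqrt hn0.le]
  calc ((k : ℝ) / n - α) ^ 2 / (b ^ 2 * n) * |d|
      ≤ 1 / (n : ℝ) ^ (1 / 4 : ℝ) / (b ^ 2 * n) * n := by gcongr
    _ = 1 / b ^ 2 / (n : ℝ) ^ (1 / 4 : ℝ) := by field_simp
    _ ≤ _ := by gcongr; norm_num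

/-- The error made when the random numbers of reads in the normalized number of matches are
replaced by deterministic ones and the degenerate part is dropped. -/
theorem normalized_sub_linear_eq {α μ k A A' B B' G : ℝ} (hα : α ∈ Set.Ioo (0 : ℝ) 1) (n : ℕ) :
    √(n : ℝ) * ((k * (n - k) * μ + (n - k) * A + k * B + G) / (α * (1 - α) * (n : ℝ) ^ 2) - μ)
      - (1 / (α * √(n : ℝ)) * A' + 1 / ((1 - α) * √(n : ℝ)) * B')
    = √(n : ℝ) * (k / n * (1 - k / n) - α * (1 - α)) * (μ / (α * (1 - α)))
      + (1 - k / n) / (α * (1 - α) * √(n : ℝ)) * (A - A')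
      + k / n / (α * (1 - α) * √(n : ℝ)) * (B - B')
      + (k / n - α) / (-(α * (1 - α)) * √(n : ℝ)) * (A' - 0)
      + (k / n - α) / (α * (1 - α) * √(n : ℝ)) * (B' - 0)
      + √(n : ℝ) / (α * (1 - α) * (n : ℝ) ^ 2) * G := by
  have h0 : α ≠ 0 := hα.1.ne'
  have h1 : 1 - α ≠ 0 := (sub_pos.2 hα.2).ne'
  rcases Nat.eq_zero_or_pos n with rfl | hn
  · simp
  · have hs : 0 < √(n : ℝ) := by positivity
    -- With n = q² the claim becomes an identity of rational functions.
    obtain ⟨q, hq⟩ : ∃ q, q = √(n : ℝ) := ⟨_, rfl⟩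
    have hn2 : (n : ℝ) = q ^ 2 := by rw [hq, Real.sq_sqrt (Nat.cast_nonneg n)]
    rw [← hq, hn2]
    have hq0 : q ≠ 0 := by rw [hq]; exact hs.ne'
    field_simp
    ring

end Equijoin

/-! ### Assembly of the limit theorem -/

open Equijoin in
theorem corollary3p1 {Ω : Type*} (F₀ : MeasurableSpace Ω) [MeasurableSpace Ω]
    (P : Measure Ω) [IsProbabilityMeasure P] (r s : PMF ℕ+) (LR LS : ℕ → Ω → ℕ+) (hL : Equijoin.IsLabelModel P r s LR LS)
    (hμ : 0 < Equijoin.matchProb r s)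
    (C : ℕ → Ω → Bool) (hC : Equijoin.IsReadingPolicy F₀ P LR LS C)
    (α : ℝ) (hα : α ∈ Set.Ioo (0 : ℝ) 1)
    (hR :
      (∀ᵐ ω ∂P, Tendsto
        (fun n : ℕ => √(n : ℝ) * ((Equijoin.readsR C n ω : ℝ) / (n : ℝ) - α)) atTop (𝓝 0)) ∨
      (α = 1 / 2 ∧ ∀ᵐ ω ∂P, Tendsto
        (fun n : ℕ => (n : ℝ) ^ (1 / 4 : ℝ) * ((Equijoin.readsR C n ω : ℝ) / (n : ℝ) - α))
        atTop (𝓝 0))) :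
    TendstoInDistribution
      (fun (n : ℕ) (ω : Ω) => √(n : ℝ) *
        ((Equijoin.numMatches LR LS C n ω : ℝ) / (α * (1 - α) * (n : ℝ) ^ 2)
          - Equijoin.matchProb r s))
      atTop (fun x : ℝ => x) (fun _ => P)
      (gaussianReal 0 (Real.toNNReal
        (((1 - α) * variance (Equijoin.matchVar s LR 0) P
          + α * variance (Equijoin.matchVar r LS 0) P) / (α * (1 - α))))) := by
  have hCm := hC.measurable hL
  have hK : ∀ n, Measurable (readsR C n) := fun n => measurable_readsR fun j _ => hCm j
  have hβ : 0 < α * (1 - α) := mul_pos hα.1 (sub_pos.2 hα.2)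
  have hw : ∀ᵐ ω ∂P, ∀ᶠ n in atTop, readsR C n ω ∈ window α n := by
    rcases hR with h | ⟨-, h⟩
    · filter_upwards [h] with ω hω
      exact eventually_mem_window (fun n => readsR_le C n ω) (tendsto_rpow_quarter_mul hω)
    · filter_upwards [h] with ω hω
      exact eventually_mem_window (fun n => readsR_le C n ω) hω
  -- Here the rate matters: the window needs only n^(1/4), while the drift needs √n unless α = 1/2.
  have hdet : ∀ᵐ ω ∂P, Tendsto (fun n : ℕ => √(n : ℝ) * ((readsR C n ω : ℝ) / n *
      (1 - (readsR C n ω : ℝ) / n) - α * (1 - α))) atTop (𝓝 0) := by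
    rcases hR with h | ⟨rfl, h⟩
    · filter_upwards [h] with ω hω
      exact tendsto_sqrt_mul_product hω
    · filter_upwards [h] with ω hω
      exact tendsto_sqrt_mul_product_half hω
  have hB : 0 < 2 / (α * (1 - α)) ^ 2 := by positivity
  have hfrac : ∀ {n k : ℕ}, k ∈ window α n → 0 ≤ (k : ℝ) / n ∧ (k : ℝ) / n ≤ 1 := fun hk =>
    ⟨by positivity, div_le_one_of_le₀ (Nat.cast_le.2 (mem_window.1 hk).1) (Nat.cast_nonneg _)⟩
  have e0 : TendstoInMeasure P (fun (n : ℕ) ω => √(n : ℝ) * ((readsR C n ω : ℝ) / n *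
      (1 - (readsR C n ω : ℝ) / n) - α * (1 - α)) * (matchProb r s / (α * (1 - α)))) atTop 0 := by
    refine tendstoInMeasure_of_tendsto_ae (fun n => ?_) ?_
    · have : Measurable fun ω => (readsR C n ω : ℝ) := measurable_from_top.comp (hK n)
      exact Measurable.aestronglyMeasurable (by fun_prop)
    · filter_upwards [hdet] with ω hω
      simpa using hω.mul_const (matchProb r s / (α * (1 - α)))
  have e1 := hL.tendstoInMeasure_mul_sum_sub_sum hK hw
    (fun n k => (1 - (k : ℝ) / n) / (α * (1 - α) * √(n : ℝ))) (fun _ k => k) (fun n _ => ⌊α * n⌋₊)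
    hB fun n hn k hk => coeff_sq_mul_abs_le hn
      (abs_le.2 ⟨by linarith [(hfrac hk).2], by linarith [(hfrac hk).1]⟩) (abs_sub_floor_le hα hn hk)
  have e2 := hL.symm.tendstoInMeasure_mul_sum_sub_sum hK hw
    (fun n k => (k : ℝ) / n / (α * (1 - α) * √(n : ℝ))) (fun n k => n - k)
    (fun n _ => n - ⌊α * n⌋₊) hB fun n hn k hk => coeff_sq_mul_abs_le hn
      (abs_le.2 ⟨by linarith [(hfrac hk).1], (hfrac hk).2⟩) (by
        rw [Nat.cast_sub (mem_window.1 hk).1, Nat.cast_sub (floor_mul_le hα n),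
          sub_sub_sub_cancel_left, abs_sub_comm]
        exact abs_sub_floor_le hα hn hk)
  -- Replacing (1 - k/n)/(α(1-α)√n) by 1/(α√n) leaves (α - k/n)/(α(1-α)√n); the sign is carried by
  -- the denominator.
  have e3 := hL.tendstoInMeasure_mul_sum_sub_sum hK hw
    (fun n k => ((k : ℝ) / n - α) / (-(α * (1 - α)) * √(n : ℝ))) (fun n _ => ⌊α * n⌋₊)
    (fun _ _ => 0) hB fun n hn k hk => by
      rw [← neg_sq (α * (1 - α))]
      refine deviation_sq_mul_abs_le hn hk ?_
      rw [Nat.cast_zero, sub_zero, Nat.abs_cast]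
      exact Nat.cast_le.2 (floor_mul_le hα n)
  have e4 := hL.symm.tendstoInMeasure_mul_sum_sub_sum hK hw
    (fun n k => ((k : ℝ) / n - α) / (α * (1 - α) * √(n : ℝ))) (fun n _ => n - ⌊α * n⌋₊)
    (fun _ _ => 0) hB fun n hn k hk => by
      refine deviation_sq_mul_abs_le hn hk ?_
      rw [Nat.cast_zero, sub_zero, Nat.abs_cast]
      exact Nat.cast_le.2 (Nat.sub_le _ _)
  have e5 := hL.tendstoInMeasure_mul_sum_kernelDev hK hw (α * (1 - α))
  refine tendstoInDistribution_of_tendstoInMeasure_sub _ _ (hL.tendstoInDistribution_linearPart hα)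
    ((((((e0.add_zero e1).add_zero e2).add_zero e3).add_zero e4).add_zero e5).congr_left
      fun n => ae_of_all _ fun ω => ?_) fun n => ?_
  · rw [Pi.sub_apply, Pi.sub_apply, linearPart, cast_numMatches r s, readsS,
      Nat.cast_sub (readsR_le C n ω), normalized_sub_linear_eq hα]
    simp only [Finset.range_zero, Finset.sum_empty]
  · have : Measurable fun ω => (numMatches LR LS C n ω : ℝ) :=
      measurable_from_top.comp (measurable_numMatches hL.measurable_LR hL.measurable_LS hCm n)
    exact Measurable.aemeasurable (by fun_prop)
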